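/- For $M \in \mathbb{R}^{n \times n}$ and $q \in \mathbb{R}^n$, the linear complementarity problem $\mathrm{LCP}(M,q)$ asks for $z \in \mathbb{R}^n$ such that $z \ge 0$ and $Mz + q \ge 0$ componentwise, and $(Mz+q)^{\top} z = 0$. The matrix $M$ is a $Q$-matrix if $\mathrm{LCP}(M,q)$ has at least one solution for every $q \in \mathbb{R}^n$, and it is strictly copositive if $x^{\top} M x > 0$ for every nonzero $x \in \mathbb{R}^n$ with $x \ge 0$ componentwise. For $\alpha \subseteq \{1,\dots,n\}$ let $C_M(\alpha) \in \mathbb{R}^{n\times n}$ be the matrix whose $j$-th column is the $j$-th column of $-M$ if $j \in \alpha$ and the $j$-th column of the identity matrix if $j \notin \alpha$. Let $\operatorname{pos} C_M(\alpha) = \{ C_M(\alpha) x : x \in \mathbb{R}^n,\ x \ge 0 \}$; these sets are the complementary cones of $M$. Let $\mathcal{F}_M$ be the field of sets generated by the complementary cones of $M$, that is, the smallest non-empty family of subsets of $\mathbb{R}^n$ that contains all of them and is closed under complements and finite unions. Two matrices $M, N \in \mathbb{R}^{n\times n}$ are LCP-equivalent if there is a homeomorphism $\varphi : \mathbb{R}^n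 \to \mathbb{R}^n$ such that $P \mapsto \varphi^{-1}(P)$ defines a Boolean isomorphism (a bijection preserving intersections and complements) from $\mathcal{F}_M$ onto $\mathcal{F}_N$. **Proposition.** Every $Q$-matrix $M \in \mathbb{R}^{2\times 2}$ is LCP-equivalent to some strictly copositive matrix $N \in \mathbb{R}^{2\times 2}$. -/

import Mathlib

open scoped Matrix

namespace LCP

variable {n : ℕ}

/-- `z` solves the linear complementarity problem `LCP(M, q)`:
`M z + q ≥ 0`, `z ≥ 0` (componentwise) and `(M z + q)ᵀ z = 0`. -/
def IsSolution (M : Matrix (Fin n) (Fin n) ℝ) (q z : Fin n → ℝ) : Prop :=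
  0 ≤ M *ᵥ z + q ∧ 0 ≤ z ∧ (M *ᵥ z + q) ⬝ᵥ z = 0

/-- `M` is a `Q`-matrix: `LCP(M, q)` has at least one solution for every `q`. -/
def IsQMatrix (M : Matrix (Fin n) (Fin n) ℝ) : Prop :=
  ∀ q : Fin n → ℝ, ∃ z : Fin n → ℝ, IsSolution M q z

/-- `xᵀ M x > 0` for every nonzero `x` in the nonnegative orthant. -/
def IsStrictlyCopositive (M : Matrix (Fin n) (Fin n) ℝ) : Prop :=
  ∀ x : Fin n → ℝ, 0 ≤ x → x ≠ 0 → 0 < x ⬝ᵥ (M *ᵥ x)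

/-- `pos A`, the cone of nonnegative combinations of the columns of `A`. -/
def pos (A : Matrix (Fin n) (Fin n) ℝ) : Set (Fin n → ℝ) :=
  {y | ∃ x : Fin n → ℝ, 0 ≤ x ∧ y = A *ᵥ x}

/-- The complementary matrix `C_M(α)`: its `j`-th column is that of `-M` if `j ∈ α`,
and that of the identity matrix otherwise. -/
def complementaryMatrix (M : Matrix (Fin n) (Fin n) ℝ) (α : Finset (Fin n)) :
    Matrix (Fin n) (Fin n) ℝ :=
  Matrix.of fun i j => if j ∈ α then -M i j else (1 : Matrix (Fin n) (Fin n) ℝ) i j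

/-- The collection of the complementary cones `pos C_M(α)` of `M`. -/
def complementaryCones (M : Matrix (Fin n) (Fin n) ℝ) : Set (Set (Fin n → ℝ)) :=
  Set.range fun α : Finset (Fin n) => pos (complementaryMatrix M α)

/-- The field of sets generated by the complementary cones of `M`: the smallest family of
subsets of `ℝⁿ` that contains them and is closed under complements and finite unions. -/
def coneField (M : Matrix (Fin n) (Fin n) ℝ) : BooleanSubalgebra (Set (Fin n → ℝ)) :=
  BooleanSubalgebra.closure (complementaryCones M)

/-- A map between fields of sets is Boolean if it preserves intersections and complements. -/
def IsBooleanMap {X Y : Type*} {F : BooleanSubalgebra (Set X)} {G : BooleanSubalgebra (Set Y)}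
    (h : F → G) : Prop :=
  (∀ P₁ P₂ : F, h (P₁ ⊓ P₂) = h P₁ ⊓ h P₂) ∧ ∀ P : F, h Pᶜ = (h P)ᶜ

/-- `M` and `N` are LCP-equivalent: there is a Boolean isomorphism between the fields of sets
generated by their complementary cones that is induced by a homeomorphism `φ` of `ℝⁿ`,
that is, it sends each `P` to the preimage of `P` under `φ`. -/
def Equivalent (M N : Matrix (Fin n) (Fin n) ℝ) : Prop :=
  ∃ (φ : (Fin n → ℝ) ≃ₜ (Fin n → ℝ)) (h : coneField M → coneField N),
    IsBooleanMap h ∧ Function.Bijective h ∧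
      ∀ P : coneField M, (h P : Set (Fin n → ℝ)) = φ ⁻¹' (P : Set (Fin n → ℝ))

end LCP

/-! A linear bijection that permutes the complementary cones is an LCP-equivalence, and cones do not
notice positive rescaling of generators. Hence positive row scaling and principal pivots preserve
the class of $M$. Testing solvability at three vectors $q$ leaves five sign patterns
(`IsQMatrix.sign_cases`). The all-positive one is already strictly copositive. With positive
principal minors a row scaling suffices (`exists_rescaling`). In the other three, a pivot on $d$, on
$a$, or on the whole matrix (inversion) gives a positive diagonal and a positive off-diagonal sum.
-/

namespace LCP

variable {n : ℕ}

/-- A homeomorphism whose preimage map carries the complementary cones of `M` onto those of `N`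
is an LCP-equivalence. -/
theorem Equivalent.of_preimage_cones {M N : Matrix (Fin n) (Fin n) ℝ}
    (φ : (Fin n → ℝ) ≃ₜ (Fin n → ℝ))
    (hφ : (fun P => φ ⁻¹' P) '' complementaryCones M = complementaryCones N) :
    Equivalent M N := by
  have fwd : ∀ P ∈ coneField M, φ ⁻¹' P ∈ coneField N := by
    intro P hP
    induction hP using BooleanSubalgebra.closure_bot_sup_induction with
    | mem P hP => exact BooleanSubalgebra.subset_closure (hφ ▸ Set.mem_image_of_mem _ hP)
    | bot => exact (coneField N).bot_mem
    | sup P _ Q _ hP hQ => exact (coneField N).supClosed hP hQ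
    | compl P _ hP => exact (coneField N).compl_mem hP
  have bwd : ∀ P ∈ coneField N, φ.symm ⁻¹' P ∈ coneField M := by
    intro P hP
    induction hP using BooleanSubalgebra.closure_bot_sup_induction with
    | mem P hP =>
      rw [← hφ] at hP
      obtain ⟨Q, hQ, rfl⟩ := hP
      have : φ.symm ⁻¹' (φ ⁻¹' Q) = Q := by ext; simp
      rw [this]
      exact BooleanSubalgebra.subset_closure hQ
    | bot => exact (coneField M).bot_mem
    | sup P _ Q _ hP hQ => exact (coneField M).supClosed hP hQ
    | compl P _ hP => exact (coneField M).compl_mem hP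
  refine ⟨φ, fun P => ⟨φ ⁻¹' P, fwd P P.2⟩, ⟨fun _ _ => rfl, fun _ => rfl⟩, ⟨?_, ?_⟩, fun _ => rfl⟩
  · intro P Q h
    exact Subtype.ext (φ.surjective.preimage_injective (congrArg Subtype.val h))
  · intro P
    refine ⟨⟨φ.symm ⁻¹' P, bwd P P.2⟩, Subtype.ext ?_⟩
    ext
    simp

theorem pos_mul_diagonal (A : Matrix (Fin n) (Fin n) ℝ) {d : Fin n → ℝ} (hd : ∀ i, 0 < d i) :
    pos (A * Matrix.diagonal d) = pos A := by
  ext y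
  constructor
  · rintro ⟨x, hx, rfl⟩
    refine ⟨Matrix.diagonal d *ᵥ x, fun i => ?_, (Matrix.mulVec_mulVec _ _ _).symm⟩
    rw [Matrix.mulVec_diagonal]
    exact mul_nonneg (hd i).le (hx i)
  · rintro ⟨x, hx, rfl⟩
    refine ⟨fun i => (d i)⁻¹ * x i, fun i => mul_nonneg (inv_nonneg.2 (hd i).le) (hx i), ?_⟩
    rw [← Matrix.mulVec_mulVec]
    congr 1
    ext i
    rw [Matrix.mulVec_diagonal, mul_inv_cancel_left₀ (hd i).ne']

/-- Linear equivalence of the complementary cones, up to a principal pivot on `γ` and positive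
rescaling of the generators, implies LCP-equivalence. -/
theorem Equivalent.of_mul_complementaryMatrix {M N : Matrix (Fin n) (Fin n) ℝ}
    (T S : Matrix (Fin n) (Fin n) ℝ) (hTS : T * S = 1) (γ : Finset (Fin n))
    (d : Finset (Fin n) → Fin n → ℝ) (hd : ∀ α i, 0 < d α i)
    (h : ∀ α, T * complementaryMatrix M (symmDiff α γ) =
      complementaryMatrix N α * Matrix.diagonal (d α)) :
    Equivalent M N := by
  have hST : S * T = 1 := mul_eq_one_comm.1 hTS
  let φ : (Fin n → ℝ) ≃ₜ (Fin n → ℝ) :=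
    { toFun := fun x => S *ᵥ x
      invFun := fun x => T *ᵥ x
      left_inv := fun x => by simp [hTS]
      right_inv := fun x => by simp [hST]
      continuous_toFun := by fun_prop
      continuous_invFun := by fun_prop }
  have key : ∀ α, φ ⁻¹' pos (complementaryMatrix M (symmDiff α γ)) =
      pos (complementaryMatrix N α) := by
    intro α
    rw [← pos_mul_diagonal (complementaryMatrix N α) (hd α), ← h]
    ext y
    constructor
    · rintro ⟨x, hx, hy⟩
      refine ⟨x, hx, ?_⟩
      rw [← Matrix.mulVec_mulVec, ← hy]
      exact (φ.symm_apply_apply y).symm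
    · rintro ⟨x, hx, rfl⟩
      refine ⟨x, hx, ?_⟩
      rw [← Matrix.mulVec_mulVec]
      exact φ.apply_symm_apply _
  refine Equivalent.of_preimage_cones φ ?_
  ext P
  constructor
  · rintro ⟨_, ⟨α, rfl⟩, rfl⟩
    refine ⟨symmDiff α γ, ?_⟩
    dsimp only
    rw [← key, symmDiff_symmDiff_cancel_right]
  · rintro ⟨α, rfl⟩
    exact ⟨_, ⟨symmDiff α γ, rfl⟩, key α⟩

/-- Rescaling the rows of `M` by positive factors gives an LCP-equivalent matrix. -/
theorem Equivalent.diagonal_mul (M : Matrix (Fin n) (Fin n) ℝ) {s : Fin n → ℝ}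
    (hs : ∀ i, 0 < s i) : Equivalent M (Matrix.diagonal s * M) := by
  -- Columns of $-M$ go exactly to columns of $-N$; only the unit vectors are stretched, by `s i`.
  refine Equivalent.of_mul_complementaryMatrix (Matrix.diagonal s)
    (Matrix.diagonal fun i => (s i)⁻¹) ?_ ∅ (fun α i => if i ∈ α then 1 else s i) ?_ ?_
  · rw [Matrix.diagonal_mul_diagonal, ← Matrix.diagonal_one]
    congr 1
    ext i
    exact mul_inv_cancel₀ (hs i).ne'
  · intro α i
    split_ifs
    exacts [one_pos, hs i]
  · intro α
    ext i j
    rw [← Finset.bot_eq_empty, symmDiff_bot, Matrix.diagonal_mul, Matrix.mul_diagonal]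
    by_cases hj : j ∈ α
    · simp [complementaryMatrix, hj]
    · by_cases hij : i = j
      · subst hij
        simp [complementaryMatrix, hj]
      · simp [complementaryMatrix, hj, hij]

/-- Only $b + c$ enters the quadratic form: a nonnegative cross term is harmless on the orthant, and
a negative discriminant makes the form positive definite. -/
theorem isStrictlyCopositive_fin_two {a b c d : ℝ} (ha : 0 < a) (hd : 0 < d)
    (h : 0 ≤ b + c ∨ (b + c) ^ 2 < 4 * (a * d)) : IsStrictlyCopositive !![a, b; c, d] := by
  intro x hx hx0
  have h0 : 0 ≤ x 0 := hx 0
  have h1 : 0 ≤ x 1 := hx 1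
  have hne : 0 < x 0 ∨ 0 < x 1 := by
    by_contra! hcon
    refine hx0 (funext fun i => ?_)
    fin_cases i
    exacts [le_antisymm hcon.1 h0, le_antisymm hcon.2 h1]
  have hform : x ⬝ᵥ (!![a, b; c, d] *ᵥ x) =
      a * x 0 ^ 2 + (b + c) * (x 0 * x 1) + d * x 1 ^ 2 := by
    simp [Matrix.mulVec, dotProduct, Fin.sum_univ_two]
    ring
  rw [hform]
  rcases h with h | h
  · have h01 : 0 ≤ (b + c) * (x 0 * x 1) := by positivity
    rcases hne with hp | hp
    · have : 0 < a * x 0 ^ 2 := by positivity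
      have : 0 ≤ d * x 1 ^ 2 := by positivity
      linarith
    · have : 0 < d * x 1 ^ 2 := by positivity
      have : 0 ≤ a * x 0 ^ 2 := by positivity
      linarith
  · rcases hne with hp | hp
    -- Complete the square after multiplying the form by $4d$ (by $4a$ in the other case).
    · have h2 : 0 < (4 * (a * d) - (b + c) ^ 2) * x 0 ^ 2 := mul_pos (sub_pos.2 h) (by positivity)
      refine pos_of_mul_pos_right (a := 4 * d) ?_ (by positivity)
      linarith [sq_nonneg ((b + c) * x 0 + 2 * d * x 1)]
    · have h2 : 0 < (4 * (a * d) - (b + c) ^ 2) * x 1 ^ 2 := mul_pos (sub_pos.2 h) (by positivity)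
      refine pos_of_mul_pos_right (a := 4 * a) ?_ (by positivity)
      linarith [sq_nonneg (2 * a * x 0 + (b + c) * x 1)]

/-- A `2 × 2` matrix with positive principal minors becomes strictly copositive after a positive
rescaling of its first row. -/
theorem exists_rescaling {a b c d : ℝ} (ha : 0 < a) (hd : 0 < d) (hdet : 0 < a * d - b * c) :
    ∃ s : ℝ, 0 < s ∧ (0 ≤ s * b + c ∨ (s * b + c) ^ 2 < 4 * (s * a * d)) := by
  have had : 0 < a * d := mul_pos ha hd
  rcases lt_trichotomy b 0 with hb | rfl | hb
  · rcases lt_trichotomy c 0 with hc | rfl | hc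
    -- This `s` symmetrizes the matrix, so the discriminant condition becomes $s(ad - bc) > 0$.
    · refine ⟨c / b, div_pos_of_neg_of_neg hc hb, Or.inr ?_⟩
      have h1 : 0 < c / b * (a * d - b * c) := mul_pos (div_pos_of_neg_of_neg hc hb) hdet
      have h2 : c / b * b = c := div_mul_cancel₀ c hb.ne
      have h3 : c / b * (b * c) = c ^ 2 := by rw [← mul_assoc, h2, sq]
      rw [h2]
      linarith
    -- With $c = 0$ the condition is $s < 4ad/b^2$.
    · refine ⟨a * d / b ^ 2, div_pos had (sq_pos_of_neg hb), Or.inr ?_⟩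
      have hb' := hb.ne
      have hb2 : 0 < b ^ 2 := sq_pos_of_neg hb
      have h1 : (a * d / b ^ 2 * b + 0) ^ 2 = (a * d) ^ 2 / b ^ 2 := by field_simp; ring
      have h2 : 4 * (a * d / b ^ 2 * a * d) = 4 * ((a * d) ^ 2 / b ^ 2) := by field_simp
      have h3 : 0 < (a * d) ^ 2 / b ^ 2 := div_pos (by positivity) hb2
      rw [h1, h2]
      linarith
    -- Opposite signs: choose `s` to cancel the off-diagonal sum.
    · refine ⟨c / -b, div_pos hc (neg_pos.2 hb), Or.inl ?_⟩
      rw [div_neg, neg_mul, div_mul_cancel₀ c hb.ne]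
      simp
  · rcases le_or_gt 0 c with hc | hc
    · exact ⟨1, one_pos, Or.inl (by simpa using hc)⟩
    · have hc2 : 0 < c ^ 2 := sq_pos_of_neg hc
      -- With $b = 0$ the condition is $s > c^2/(4ad)$.
      refine ⟨c ^ 2 / (a * d), by positivity, Or.inr ?_⟩
      rw [mul_assoc, div_mul_cancel₀ _ had.ne']
      linarith
  · rcases le_or_gt 0 c with hc | hc
    · exact ⟨1, one_pos, Or.inl (by linarith)⟩
    · refine ⟨-c / b, div_pos (neg_pos.2 hc) hb, Or.inl ?_⟩
      rw [div_mul_cancel₀ _ hb.ne']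
      simp

theorem IsQMatrix.exists_fin_two {a b c d : ℝ} (h : IsQMatrix !![a, b; c, d]) (p q : ℝ) :
    ∃ x y : ℝ, 0 ≤ x ∧ 0 ≤ y ∧ 0 ≤ a * x + b * y + p ∧ 0 ≤ c * x + d * y + q ∧
      (a * x + b * y + p = 0 ∨ x = 0) ∧ (c * x + d * y + q = 0 ∨ y = 0) := by
  obtain ⟨z, hw, hz, hc⟩ := h ![p, q]
  have hw0 := hw 0
  have hw1 := hw 1
  have hz0 : 0 ≤ z 0 := hz 0
  have hz1 : 0 ≤ z 1 := hz 1
  simp [dotProduct, Fin.sum_univ_two] at hw0 hw1 hc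
  have h0 := mul_nonneg hw0 hz0
  have h1 := mul_nonneg hw1 hz1
  exact ⟨z 0, z 1, hz0, hz1, hw0, hw1, mul_eq_zero.1 (by linarith), mul_eq_zero.1 (by linarith)⟩

/-- Sign patterns of the `2 × 2` `Q`-matrices. -/
theorem IsQMatrix.sign_cases {a b c d : ℝ} (h : IsQMatrix !![a, b; c, d]) :
    (0 < a ∧ 0 < d ∧ 0 < a * d - b * c) ∨ (0 < a ∧ 0 < b ∧ 0 < c ∧ 0 < d) ∨
    (0 < b ∧ c < 0 ∧ 0 < d ∧ 0 < a * d - b * c) ∨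
    (0 < a ∧ b < 0 ∧ 0 < c ∧ 0 < a * d - b * c) ∨
    (a < 0 ∧ 0 < b ∧ 0 < c ∧ d < 0 ∧ a * d - b * c < 0) := by
  obtain ⟨x₁, y₁, hx₁, hy₁, hv₁, hw₁, hxv₁, hyw₁⟩ := h.exists_fin_two (-1) (-1)
  obtain ⟨x₂, y₂, hx₂, hy₂, hv₂, hw₂, hxv₂, hyw₂⟩ := h.exists_fin_two (-1) 1
  obtain ⟨x₃, y₃, hx₃, hy₃, hv₃, hw₃, hxv₃, hyw₃⟩ := h.exists_fin_two 1 (-1)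
  have row₁ : a ≤ 0 → 0 < b := by
    intro ha
    by_contra! hb
    linarith [mul_nonpos_of_nonpos_of_nonneg ha hx₁, mul_nonpos_of_nonpos_of_nonneg hb hy₁]
  have row₂ : d ≤ 0 → 0 < c := by
    intro hd
    by_contra! hc
    linarith [mul_nonpos_of_nonpos_of_nonneg hc hx₁, mul_nonpos_of_nonpos_of_nonneg hd hy₁]
  rcases lt_or_ge 0 a with ha | ha <;> rcases lt_or_ge 0 d with hd | hd
  · rcases lt_or_ge 0 (a * d - b * c) with hdet | hdet
    · exact Or.inl ⟨ha, hd, hdet⟩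
    have hbc : 0 < b * c := by linarith [mul_pos ha hd]
    rcases pos_and_pos_or_neg_and_neg_of_mul_pos hbc with ⟨hb, hc⟩ | ⟨hb, hc⟩
    · exact Or.inr (Or.inl ⟨ha, hb, hc, hd⟩)
    exfalso
    -- Eliminating $x_1$ from the two inequalities gives $(ad - bc)y_1 + c - a \ge 0$, impossible
    -- since $c < 0 < a$.
    linarith [mul_nonneg (neg_nonneg.2 hc.le) hv₁, mul_nonneg ha.le hw₁,
      mul_nonpos_of_nonpos_of_nonneg hdet hy₁]
  · have hc := row₂ hd
    have hx : 0 < x₃ := by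
      refine hx₃.lt_of_ne' fun h0 => ?_
      subst h0
      linarith [mul_nonpos_of_nonpos_of_nonneg hd hy₃]
    have hv : a * x₃ + b * y₃ + 1 = 0 := hxv₃.resolve_right hx.ne'
    have hby : b * y₃ < 0 := by linarith [mul_pos ha hx]
    have hb : b < 0 := by
      by_contra! hb
      linarith [mul_nonneg hb hy₃]
    have hw : c * x₃ + d * y₃ + -1 = 0 := hyw₃.resolve_right (by rintro rfl; simp at hby)
    refine Or.inr (Or.inr (Or.inr (Or.inl ⟨ha, hb, hc, ?_⟩)))
    -- Both rows are tight, so Cramer's rule gives the sign of the determinant.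
    have e : (a * d - b * c) * y₃ = a + c := by linear_combination a * hw - c * hv
    exact pos_of_mul_pos_left (e ▸ add_pos ha hc) hy₃
  · have hb := row₁ ha
    have hy : 0 < y₂ := by
      refine hy₂.lt_of_ne' fun h0 => ?_
      subst h0
      linarith [mul_nonpos_of_nonpos_of_nonneg ha hx₂]
    have hw : c * x₂ + d * y₂ + 1 = 0 := hyw₂.resolve_right hy.ne'
    have hcx : c * x₂ < 0 := by linarith [mul_pos hd hy]
    have hc : c < 0 := by
      by_contra! hc
      linarith [mul_nonneg hc hx₂]
    have hv : a * x₂ + b * y₂ + -1 = 0 := hxv₂.resolve_right (by rintro rfl; simp at hcx)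
    refine Or.inr (Or.inr (Or.inl ⟨hb, hc, hd, ?_⟩))
    have e : (a * d - b * c) * x₂ = d + b := by linear_combination d * hv - b * hw
    exact pos_of_mul_pos_left (e ▸ add_pos hd hb) hx₂
  · have hb := row₁ ha
    have hc := row₂ hd
    have hy : 0 < y₂ := by
      refine hy₂.lt_of_ne' fun h0 => ?_
      subst h0
      linarith [mul_nonpos_of_nonpos_of_nonneg ha hx₂]
    have hw : c * x₂ + d * y₂ + 1 = 0 := hyw₂.resolve_right hy.ne'
    have hd' : d < 0 := by
      by_contra! hd'
      linarith [mul_nonneg hc.le hx₂, mul_nonneg hd' hy₂]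
    have hx : 0 < x₃ := by
      refine hx₃.lt_of_ne' fun h0 => ?_
      subst h0
      linarith [mul_nonpos_of_nonpos_of_nonneg hd hy₃]
    have hv : a * x₃ + b * y₃ + 1 = 0 := hxv₃.resolve_right hx.ne'
    have ha' : a < 0 := by
      by_contra! ha'
      linarith [mul_nonneg ha' hx₃, mul_nonneg hb.le hy₃]
    refine Or.inr (Or.inr (Or.inr (Or.inr ⟨ha', hb, hc, hd', ?_⟩)))
    by_contra! hdet
    -- Eliminating $x_1$ gives $a - c \ge (ad - bc)y_1 \ge 0$, against $a < 0 < c$.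
    linarith [mul_nonneg hc.le hv₁, mul_nonneg (neg_nonneg.2 ha) hw₁, mul_nonneg hdet hy₁]

theorem Equivalent.refl (M : Matrix (Fin n) (Fin n) ℝ) : Equivalent M M := by
  simpa using Equivalent.diagonal_mul M (s := 1) fun _ => one_pos

/-- Principal pivot on the second diagonal entry. -/
theorem Equivalent.pivot_one {a b c d : ℝ} (hd : d ≠ 0) :
    Equivalent !![a, b; c, d] !![(a * d - b * c) / d, b / d; -c / d, 1 / d] := by
  -- Here `S` is $C_M(\gamma)$ itself, so its inverse `T` carries the cone of $\gamma$ to the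
  -- orthant.
  refine Equivalent.of_mul_complementaryMatrix !![1, -b / d; 0, -1 / d] !![1, -b; 0, -d]
    ?_ {1} (fun _ _ => 1) (fun _ _ => one_pos) fun α => ?_
  · ext i j
    fin_cases i <;> fin_cases j <;> simp <;> field_simp <;> ring
  · ext i j
    rw [Matrix.mul_diagonal, mul_one]
    by_cases h0 : (0 : Fin 2) ∈ α <;> by_cases h1 : (1 : Fin 2) ∈ α <;> fin_cases i <;>
      fin_cases j <;>
      simp [complementaryMatrix, Matrix.mul_apply, Fin.sum_univ_two, Finset.mem_symmDiff, h0, h1]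
      <;> field_simp <;> ring

/-- Principal pivot on the first diagonal entry. -/
theorem Equivalent.pivot_zero {a b c d : ℝ} (ha : a ≠ 0) :
    Equivalent !![a, b; c, d] !![1 / a, -b / a; c / a, (a * d - b * c) / a] := by
  refine Equivalent.of_mul_complementaryMatrix !![-1 / a, 0; -c / a, 1] !![-a, 0; -c, 1]
    ?_ {0} (fun _ _ => 1) (fun _ _ => one_pos) fun α => ?_
  · ext i j
    fin_cases i <;> fin_cases j <;> simp <;> field_simp <;> ring
  · ext i j
    rw [Matrix.mul_diagonal, mul_one]
    by_cases h0 : (0 : Fin 2) ∈ α <;> by_cases h1 : (1 : Fin 2) ∈ α <;> fin_cases i <;>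
      fin_cases j <;>
      simp [complementaryMatrix, Matrix.mul_apply, Fin.sum_univ_two, Finset.mem_symmDiff, h0, h1]
      <;> field_simp <;> ring

/-- An invertible matrix is LCP-equivalent to its inverse. -/
theorem Equivalent.of_mul_eq_one {M N : Matrix (Fin n) (Fin n) ℝ} (h : N * M = 1) :
    Equivalent M N := by
  refine Equivalent.of_mul_complementaryMatrix (-N) (-M) (by rw [neg_mul_neg, h]) Finset.univ
    (fun _ _ => 1) (fun _ _ => one_pos) fun α => ?_
  ext i j
  rw [Matrix.mul_diagonal, mul_one]
  by_cases hj : j ∈ α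
  · simp [complementaryMatrix, Matrix.mul_apply, Finset.mem_symmDiff, hj, Matrix.one_apply]
  · simpa [complementaryMatrix, Matrix.mul_apply, Finset.mem_symmDiff, hj] using
      congrFun (congrFun h i) j

end LCP

theorem mainTheorem9 (M : Matrix (Fin 2) (Fin 2) ℝ) (hM : LCP.IsQMatrix M) :
    ∃ N : Matrix (Fin 2) (Fin 2) ℝ, LCP.IsStrictlyCopositive N ∧ LCP.Equivalent M N := by
  obtain ⟨a, b, c, d, rfl⟩ : ∃ a b c d : ℝ, M = !![a, b; c, d] :=
    ⟨_, _, _, _, Matrix.eta_fin_two M⟩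
  rcases hM.sign_cases with ⟨ha, hd, hdet⟩ | ⟨ha, hb, hc, hd⟩ | ⟨hb, hc, hd, hdet⟩ |
    ⟨ha, hb, hc, hdet⟩ | ⟨ha, hb, hc, hd, hdet⟩
  · obtain ⟨s, hs, h⟩ := LCP.exists_rescaling ha hd hdet
    refine ⟨!![s * a, s * b; c, d], LCP.isStrictlyCopositive_fin_two (mul_pos hs ha) hd h, ?_⟩
    have hs' : ∀ i : Fin 2, 0 < ![s, 1] i := by
      intro i
      fin_cases i
      exacts [hs, one_pos]
    convert LCP.Equivalent.diagonal_mul !![a, b; c, d] hs' using 1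
    ext i j
    fin_cases i <;> fin_cases j <;> simp [Matrix.diagonal_mul]
  · exact ⟨_, LCP.isStrictlyCopositive_fin_two ha hd (Or.inl (add_pos hb hc).le),
      LCP.Equivalent.refl _⟩
  · exact ⟨_, LCP.isStrictlyCopositive_fin_two (div_pos hdet hd) (one_div_pos.2 hd)
      (Or.inl (add_pos (div_pos hb hd) (div_pos (neg_pos.2 hc) hd)).le),
      LCP.Equivalent.pivot_one hd.ne'⟩
  · exact ⟨_, LCP.isStrictlyCopositive_fin_two (one_div_pos.2 ha) (div_pos hdet ha)
      (Or.inl (add_pos (div_pos (neg_pos.2 hb) ha) (div_pos hc ha)).le),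
      LCP.Equivalent.pivot_zero ha.ne'⟩
  · obtain ⟨D, hD⟩ : ∃ D, D = a * d - b * c := ⟨_, rfl⟩
    rw [← hD] at hdet
    -- The inverse matrix; every entry is a quotient of two negative numbers.
    refine ⟨!![d / D, -b / D; -c / D, a / D],
      LCP.isStrictlyCopositive_fin_two (div_pos_of_neg_of_neg hd hdet)
      (div_pos_of_neg_of_neg ha hdet) (Or.inl (add_pos
        (div_pos_of_neg_of_neg (neg_neg_of_pos hb) hdet)
        (div_pos_of_neg_of_neg (neg_neg_of_pos hc) hdet)).le), LCP.Equivalent.of_mul_eq_one ?_⟩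
    have hdet' := hdet.ne
    ext i j
    fin_cases i <;> fin_cases j <;> simp <;> field_simp <;> linarith
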